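/- \textbf{Theorem (Convergence of EMA).} Let $\mathcal X$ be a finite-dimensional Euclidean space and let $f:\mathcal X\to\mathbb R_+\cup\{+\infty\}$ be a proper closed nonnegative convex function with $\inf f>0$ and $\operatorname{argmin} f\neq\emptyset$. Let $f_\infty$ be the recession function of $f$ (the function whose epigraph is the recession cone of the epigraph of $f$), and let $f^\pi:\mathcal X\times\mathbb R\to\mathbb R_+\cup\{+\infty\}$ be the closed perspective function \[ f^\pi(x,\lambda)=\begin{cases}\lambda f(\lambda^{-1}x)&\text{if }\lambda>0,\\ f_\infty(x)&\text{if }\lambda=0,\\ +\infty&\text{if }\lambda<0.\end{cases} \] For $\alpha>0$ define the projected polar envelope of $f$ by \[ p_{\alpha,f}(x)=\inf_{(z,\lambda)\in\mathcal X\times\mathbb R}\max\Big\{f^\pi(z,\lambda),\ \tfrac1\alpha\big\|(x,1)-(z,\lambda)\big\|_2\Big\},\qquad x\in\mathcal X . \] Then $p_{\alpha,f}$ is real-valued and differentiable on $\mathcal X$. Let $\sigma\in(0,1)$ and let $\beta_k>0$ $(k\ge 0)$ satisfy $0<\inf_k\beta_k\le\sup_k\beta_k<\infty$. For every starting point $x_0\in\mathcal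 X$ the following iteration is well defined (the integer $t$ exists at every step): for $k=0,1,2,\dots$, let $t\ge0$ be the smallest integer with \[ p_{\alpha,f}\big(x_k-2^{-t}\beta_k\nabla p_{\alpha,f}(x_k)\big)\le p_{\alpha,f}(x_k)-\sigma\,2^{-t}\beta_k\,\|\nabla p_{\alpha,f}(x_k)\|_2^2, \] and set $x_{k+1}=x_k-2^{-t}\beta_k\nabla p_{\alpha,f}(x_k)$. Moreover, every sequence $\{x_k\}$ generated in this way converges to a global minimizer of $p_{\alpha,f}$. -/

import Mathlib

open Set Filter Topology
open scoped ENNReal NNReal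

noncomputable section

/-- The epigraph of an extended-valued nonnegative function, as a subset of `X × ℝ`. -/
def epi {X : Type*} (f : X → ℝ≥0∞) : Set (X × ℝ) :=
  {p | 0 ≤ p.2 ∧ f p.1 ≤ ENNReal.ofReal p.2}

/-- The recession function of a proper closed convex function `f ≥ 0`: the function whose epigraph
is the recession (asymptotic) cone of the epigraph of `f`. Since `f ≥ 0`, every `(d, μ)` in that
cone has `μ ≥ 0`, so only nonnegative heights occur in the infimum. -/
def recFun {X : Type*} [NormedAddCommGroup X] [InnerProductSpace ℝ X]
    (f : X → ℝ≥0∞) (d : X) : ℝ≥0∞ :=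
  ⨅ (μ : ℝ≥0) (_ : (d, (μ : ℝ)) ∈ asymptoticCone ℝ (epi f)), (μ : ℝ≥0∞)

/-- The closed perspective `f^π(x, l)` on `X × ℝ`, which carries the Euclidean product norm. -/
def perspective {X : Type*} [NormedAddCommGroup X] [InnerProductSpace ℝ X]
    (f : X → ℝ≥0∞) (z : WithLp 2 (X × ℝ)) : ℝ≥0∞ :=
  if 0 < z.snd then ENNReal.ofReal z.snd * f (z.snd⁻¹ • z.fst)
  else if z.snd = 0 then recFun f z.fst
  else ⊤

/-- The infimal max convolution of two nonnegative extended-valued functions. -/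
def maxConv {E : Type*} [AddCommGroup E] (f₁ f₂ : E → ℝ≥0∞) (x : E) : ℝ≥0∞ :=
  ⨅ z, max (f₁ z) (f₂ (x - z))

/-- The polar envelope `κ_α`: the max convolution of `κ` with `(1/α) ‖·‖`. -/
def polarEnvelope {E : Type*} [NormedAddCommGroup E] (α : ℝ) (κ : E → ℝ≥0∞) : E → ℝ≥0∞ :=
  maxConv κ (fun z => ENNReal.ofReal (1 / α * ‖z‖))

/-- The projected polar envelope `x ↦ (f^π)_α (x, 1)`, as an extended-valued function. -/
def projPolarEnvelopeENN {X : Type*} [NormedAddCommGroup X] [InnerProductSpace ℝ X]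
    (α : ℝ) (f : X → ℝ≥0∞) (x : X) : ℝ≥0∞ :=
  polarEnvelope α (perspective f) (WithLp.toLp 2 (x, (1 : ℝ)))

/-- For proper `f` the projected polar envelope is finite everywhere, so that passing to real
values below loses nothing. -/
theorem projPolarEnvelopeENN_ne_top {X : Type*} [NormedAddCommGroup X] [InnerProductSpace ℝ X]
    (α : ℝ) (f : X → ℝ≥0∞) (hf : ∃ x, f x ≠ ⊤) (x : X) : projPolarEnvelopeENN α f x ≠ ⊤ := by
  obtain ⟨y, hy⟩ := hf
  have h0 : perspective f (0 : WithLp 2 (X × ℝ)) = 0 := by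
    have hr : recFun f (0 : X) = 0 := by
      refine le_antisymm ?_ bot_le
      refine (iInf₂_le (0 : ℝ≥0) ?_).trans (by simp)
      have h : (0 : X × ℝ) ∈ asymptoticCone ℝ (epi f) :=
        zero_mem_asymptoticCone.2
          ⟨(y, (f y).toReal), ENNReal.toReal_nonneg, (ENNReal.ofReal_toReal hy).ge⟩
      exact h
    simp [perspective, hr]
  refine ne_top_of_le_ne_top ?_ (iInf_le _ (0 : WithLp 2 (X × ℝ)))
  rw [h0]
  simp

/-- The projected polar envelope as a real-valued function. -/
def projPolarEnvelope {X : Type*} [NormedAddCommGroup X] [InnerProductSpace ℝ X]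
    (α : ℝ) (f : X → ℝ≥0∞) (x : X) : ℝ :=
  (projPolarEnvelopeENN α f x).toReal

/-- The gradient on a finite-dimensional Euclidean space (which is automatically complete). -/
def grad {X : Type*} [NormedAddCommGroup X] [InnerProductSpace ℝ X] [FiniteDimensional ℝ X]
    (p : X → ℝ) (x : X) : X :=
  haveI : CompleteSpace X := FiniteDimensional.complete ℝ X
  gradient p x

/-- The Armijo sufficient-decrease test for the trial step `2^{-t} b` at the point `y`. -/
def ArmijoTest {X : Type*} [NormedAddCommGroup X] [InnerProductSpace ℝ X] [FiniteDimensional ℝ X]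
    (p : X → ℝ) (σ b : ℝ) (y : X) (t : ℕ) : Prop :=
  p (y - ((1 / 2 : ℝ) ^ t * b) • grad p y) ≤ p y - σ * ((1 / 2 : ℝ) ^ t * b) * ‖grad p y‖ ^ 2

/-- `x` is generated by the steepest-descent method with Armijo line search applied to `p`, with
parameter `σ` and initial trial steps `β k`: at each iteration the smallest `t ≥ 0` that passes the
Armijo test is found, and the corresponding gradient step is made. -/
def IsArmijoDescentSequence {X : Type*} [NormedAddCommGroup X] [InnerProductSpace ℝ X]
    [FiniteDimensional ℝ X] (p : X → ℝ) (σ : ℝ) (β : ℕ → ℝ) (x : ℕ → X) : Prop :=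
  ∀ k, ∃ t : ℕ, IsLeast {s : ℕ | ArmijoTest p σ (β k) (x k) s} t ∧
    x (k + 1) = x k - ((1 / 2 : ℝ) ^ t * β k) • grad p (x k)

end

/-! The polar envelope of `f^π` is the gauge of D + αB, where D is the closed convex set `closure
(perspectiveBall f)` and B the unit ball; `p` is its restriction to scale 1
(`isThickeningGauge_polarEnvelope`). Each boundary point u of a thickening has a nearest point c in
D, and the ball of radius α about c lies in the thickening and touches its boundary at u. The
supporting half-space at u bounds the gauge below by a linear function, and the ball bounds it above
by the same function plus a quadratic term, uniformly where the gauge is bounded away from 0 and the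
argument is bounded (`IsThickeningGauge.exists_quadratic_bound`). Hence `p` is differentiable with
gradient at most 1/α: `inf f > 0` keeps `p` away from 0, and a minimizer of `f` rescales to one of
`p`. The quadratic bounds are uniform only on balls, but quasi-Fejér monotonicity keeps the iterates
bounded. Armijo steps then stay bounded below, gradients tend to 0, cluster points are minimizers,
and monotonicity upgrades subsequential to full convergence. -/

/-! ### Convergence of Armijo descent for convex functions -/

section ArmijoDescent

variable {X : Type*} [NormedAddCommGroup X] [InnerProductSpace ℝ X] [FiniteDimensional ℝ X]

local notation "⟪" x ", " y "⟫" => inner ℝ x y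

omit [FiniteDimensional ℝ X] in
/-- A quadratic upper bound makes all short enough steps pass the Armijo inequality. -/
theorem armijo_inequality_of_quadratic_bound {p : X → ℝ} {σ K δ τ : ℝ} {x g : X}
    (hK : ∀ h, ‖h‖ ≤ δ → p (x + h) ≤ p x + ⟪g, h⟫ + K * ‖h‖ ^ 2)
    (hτ : 0 ≤ τ) (hτδ : τ * ‖g‖ ≤ δ) (hτK : K * τ ≤ 1 - σ) :
    p (x - τ • g) ≤ p x - σ * τ * ‖g‖ ^ 2 := by
  have hn : ‖-(τ • g)‖ = τ * ‖g‖ := by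
    rw [norm_neg, norm_smul, Real.norm_of_nonneg hτ]
  have h := hK (-(τ • g)) (hn.trans_le hτδ)
  rw [hn, inner_neg_right, inner_smul_right, real_inner_self_eq_norm_sq, ← sub_eq_add_neg] at h
  have : 0 ≤ τ * ‖g‖ ^ 2 := by positivity
  nlinarith [mul_le_mul_of_nonneg_right hτK this]

/-- Under a quadratic upper bound, the Armijo search stops, and its step is bounded below. -/
theorem armijoTest_of_le {p : X → ℝ} {σ K δ L b : ℝ} {x : X}
    (hKpos : 0 < K) (hL : 0 ≤ L) (hg : ‖grad p x‖ ≤ L) (hb : 0 < b)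
    (hK : ∀ h, ‖h‖ ≤ δ → p (x + h) ≤ p x + ⟪grad p x, h⟫ + K * ‖h‖ ^ 2) {t : ℕ}
    (ht : (1 / 2 : ℝ) ^ t * b ≤ min (δ / (L + 1)) ((1 - σ) / K)) :
    ArmijoTest p σ b x t := by
  have hτ : 0 ≤ (1 / 2 : ℝ) ^ t * b := by positivity
  refine armijo_inequality_of_quadratic_bound hK hτ ?_ ?_
  · have h1 := ht.trans (min_le_left _ _)
    rw [le_div_iff₀ (by positivity)] at h1
    exact (mul_le_mul_of_nonneg_left (hg.trans (by linarith)) hτ).trans h1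
  · have h1 := ht.trans (min_le_right _ _)
    rwa [le_div_iff₀ hKpos, mul_comm] at h1

theorem exists_isArmijoDescentSequence {p : X → ℝ} {σ : ℝ} {β : ℕ → ℝ}
    (h : ∀ k x, ∃ t, ArmijoTest p σ (β k) x t) (x₀ : X) :
    ∃ x : ℕ → X, x 0 = x₀ ∧ IsArmijoDescentSequence p σ β x := by
  classical
  refine ⟨fun n => Nat.rec x₀
    (fun k y => y - ((1 / 2 : ℝ) ^ (Nat.find (h k y)) * β k) • grad p y) n, rfl, fun k => ?_⟩
  exact ⟨Nat.find (h k _), ⟨Nat.find_spec (h k _), fun s hs => Nat.find_min' _ hs⟩, rfl⟩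

variable {p : X → ℝ} {σ : ℝ} {β : ℕ → ℝ} {x : ℕ → X} {z : X}

/-- The data of one step of the Armijo method. -/
theorem IsArmijoDescentSequence.exists_step (hx : IsArmijoDescentSequence p σ β x)
    (hβ : ∀ k, 0 < β k) (k : ℕ) :
    ∃ τ, 0 < τ ∧ τ ≤ β k ∧ x (k + 1) = x k - τ • grad p (x k) ∧
      σ * τ * ‖grad p (x k)‖ ^ 2 ≤ p (x k) - p (x (k + 1)) := by
  obtain ⟨t, ht, hk⟩ := hx k
  have h := ht.1
  simp only [mem_ofPred_eq, ArmijoTest, ← hk] at h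
  refine ⟨_, mul_pos (by positivity) (hβ k), ?_, hk, by linarith⟩
  exact mul_le_of_le_one_left (hβ k).le (pow_le_one₀ (by norm_num) (by norm_num))

theorem IsArmijoDescentSequence.antitone (hx : IsArmijoDescentSequence p σ β x)
    (hβ : ∀ k, 0 < β k) (hσ : 0 < σ) : Antitone (p ∘ x) := by
  refine antitone_nat_of_succ_le fun k => ?_
  obtain ⟨τ, hτ, -, -, h⟩ := hx.exists_step hβ k
  have : 0 ≤ σ * τ * ‖grad p (x k)‖ ^ 2 := by positivity
  simp only [Function.comp]
  linarith

/-- Quasi-Fejér monotonicity of the Armijo method with respect to the set of minimizers. -/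
theorem IsArmijoDescentSequence.antitone_norm_sub_sq_add (hx : IsArmijoDescentSequence p σ β x)
    (hβ : ∀ k, 0 < β k) (hσ : 0 < σ) {B : ℝ} (hB : ∀ k, β k ≤ B)
    (hsub : ∀ x y, p x + ⟪grad p x, y - x⟫ ≤ p y) (hz : IsMinOn p univ z) :
    Antitone fun k => ‖x k - z‖ ^ 2 + B / σ * p (x k) := by
  refine antitone_nat_of_succ_le fun k => ?_
  obtain ⟨τ, hτ, hτβ, hk, h⟩ := hx.exists_step hβ k
  have h1 : ‖x (k + 1) - z‖ ^ 2 =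
      ‖x k - z‖ ^ 2 - 2 * (τ * ⟪grad p (x k), x k - z⟫) + τ ^ 2 * ‖grad p (x k)‖ ^ 2 := by
    rw [hk, show x k - τ • grad p (x k) - z = (x k - z) - τ • grad p (x k) by abel,
      norm_sub_sq_real, inner_smul_right, norm_smul, mul_pow, real_inner_comm,
      Real.norm_of_nonneg hτ.le]
  have h2 : 0 ≤ ⟪grad p (x k), x k - z⟫ := by
    have h3 := hsub (x k) z
    rw [← neg_sub (x k) z, inner_neg_right] at h3
    have := isMinOn_iff.1 hz (x k) (mem_univ _)
    linarith
  -- The quadratic error is at most B τ‖g‖², which the Armijo test bounds by B/σ times the decrease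
  -- of `p`; hence the weight B/σ in the potential.
  have h3 : τ ^ 2 * ‖grad p (x k)‖ ^ 2 ≤ B * (τ * ‖grad p (x k)‖ ^ 2) := by
    rw [sq, mul_assoc]
    exact mul_le_mul_of_nonneg_right (hτβ.trans (hB k)) (by positivity)
  have hB0 : 0 < B := (hβ 0).trans_le (hB 0)
  have h4 : τ * ‖grad p (x k)‖ ^ 2 ≤ (p (x k) - p (x (k + 1))) / σ := by
    rw [le_div_iff₀ hσ]
    linarith
  have h5 := mul_le_mul_of_nonneg_left h4 hB0.le
  have h6 : B * ((p (x k) - p (x (k + 1))) / σ) = B / σ * p (x k) - B / σ * p (x (k + 1)) := by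
    ring
  have h7 := mul_nonneg hτ.le h2
  linarith

theorem IsArmijoDescentSequence.exists_tendsto_comp (hx : IsArmijoDescentSequence p σ β x)
    (hβ : ∀ k, 0 < β k) (hσ : 0 < σ) (hz : IsMinOn p univ z) :
    ∃ P, Tendsto (fun k => p (x k)) atTop (𝓝 P) :=
  ⟨_, tendsto_atTop_ciInf (hx.antitone hβ hσ)
    ⟨p z, by rintro _ ⟨k, rfl⟩; exact isMinOn_iff.1 hz _ (mem_univ _)⟩⟩

theorem IsArmijoDescentSequence.exists_tendsto_norm_sub_sq (hx : IsArmijoDescentSequence p σ β x)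
    (hβ : ∀ k, 0 < β k) (hσ : 0 < σ) {B : ℝ} (hB : ∀ k, β k ≤ B)
    (hsub : ∀ x y, p x + ⟪grad p x, y - x⟫ ≤ p y) (hz : IsMinOn p univ z) :
    ∃ Q, Tendsto (fun k => ‖x k - z‖ ^ 2) atTop (𝓝 Q) := by
  obtain ⟨P, hP⟩ := hx.exists_tendsto_comp hβ hσ hz
  have hB0 : 0 < B := (hβ 0).trans_le (hB 0)
  have h := tendsto_atTop_ciInf (hx.antitone_norm_sub_sq_add hβ hσ hB hsub hz)
    ⟨B / σ * p z, by
      rintro _ ⟨k, rfl⟩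
      have h1 := isMinOn_iff.1 hz (x k) (mem_univ _)
      have h2 : 0 ≤ B / σ := by positivity
      have h3 := mul_le_mul_of_nonneg_left h1 h2
      have h4 := sq_nonneg ‖x k - z‖
      simp only
      linarith⟩
  refine ⟨_, (h.sub (hP.const_mul (B / σ))).congr fun k => ?_⟩
  ring

/-- The Armijo method on a convex function with bounded gradient, and with quadratic upper bounds
that are uniform on balls, converges to a minimizer as soon as there is one. -/
theorem IsArmijoDescentSequence.exists_tendsto (hx : IsArmijoDescentSequence p σ β x)
    (hβ : ∀ k, 0 < β k) (hσ : 0 < σ) (hσ1 : σ < 1) {B b L : ℝ} (hB : ∀ k, β k ≤ B)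
    (hb : 0 < b) (hbβ : ∀ k, b ≤ β k) (hp : Continuous p)
    (hsub : ∀ x y, p x + ⟪grad p x, y - x⟫ ≤ p y) (hL : ∀ x, ‖grad p x‖ ≤ L)
    (hquad : ∀ R, ∃ K > 0, ∃ δ > 0, ∀ x, ‖x‖ ≤ R → ∀ h, ‖h‖ ≤ δ →
      p (x + h) ≤ p x + ⟪grad p x, h⟫ + K * ‖h‖ ^ 2) (hz : IsMinOn p univ z) :
    ∃ xs, IsMinOn p univ xs ∧ Tendsto x atTop (𝓝 xs) := by
  obtain ⟨P, hP⟩ := hx.exists_tendsto_comp hβ hσ hz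
  obtain ⟨Q, hQ⟩ := hx.exists_tendsto_norm_sub_sq hβ hσ hB hsub hz
  obtain ⟨M, hM⟩ := hQ.bddAbove_range
  have hM' : ∀ k, ‖x k - z‖ ≤ √M := fun k => Real.le_sqrt_of_sq_le (hM ⟨k, rfl⟩)
  set R := √M + ‖z‖
  have hR : ∀ k, ‖x k‖ ≤ R := fun k => by
    have := norm_add_le (x k - z) z
    rw [sub_add_cancel] at this
    linarith [hM' k]
  have hL0 : 0 ≤ L := (norm_nonneg _).trans (hL z)
  obtain ⟨K, hK, δ, hδ, hq⟩ := hquad R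
  set τ₀ := min (δ / (L + 1)) ((1 - σ) / K) with hτ₀
  have hτ₀pos : 0 < τ₀ := lt_min (by positivity) (div_pos (by linarith) hK)
  -- Lower bound on accepted steps: either the first trial `β k ≥ b` passes, or the preceding trial,
  -- twice as long, failed and so exceeded `τ₀`.
  set m := min b (τ₀ / 2)
  have hm : 0 < m := lt_min hb (by positivity)
  have hdec : ∀ k, ‖grad p (x k)‖ ^ 2 ≤ (p (x k) - p (x (k + 1))) / (σ * m) := by
    intro k
    obtain ⟨t, ht, hk⟩ := hx k
    have h := ht.1
    simp only [mem_ofPred_eq, ArmijoTest, ← hk] at h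
    have hmt : m ≤ (1 / 2 : ℝ) ^ t * β k := by
      rcases t with _ | s
      · rw [pow_zero, one_mul]
        exact (min_le_left _ _).trans (hbβ k)
      · have hs : ¬ (1 / 2 : ℝ) ^ s * β k ≤ τ₀ := fun hle => by
          have := ht.2 (armijoTest_of_le hK hL0 (hL _) (hβ k) (hq _ (hR k)) hle)
          omega
        refine (min_le_right _ _).trans ?_
        rw [pow_succ]
        linarith
    rw [le_div_iff₀ (by positivity)]
    have := mul_le_mul_of_nonneg_left hmt (by positivity : 0 ≤ σ * ‖grad p (x k)‖ ^ 2)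
    linarith
  have hg2 : Tendsto (fun k => ‖grad p (x k)‖ ^ 2) atTop (𝓝 0) := by
    refine squeeze_zero (fun k => by positivity) hdec ?_
    have h := (hP.sub (hP.comp (tendsto_add_atTop_nat 1))).div_const (σ * m)
    simpa using h
  have hg : Tendsto (fun k => ‖grad p (x k)‖) atTop (𝓝 0) := by
    have := hg2.sqrt
    simpa using this
  obtain ⟨xs, -, φ, hφ, hlim⟩ := tendsto_subseq_of_bounded (Metric.isBounded_closedBall (x := 0)
    (r := R)) (fun k => by simpa using hR k : ∀ k, x k ∈ Metric.closedBall (0 : X) R)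
  have hmin : IsMinOn p univ xs := by
    have hle : p xs ≤ p z := by
      have h1 : ∀ k, p (x k) ≤ p z + ‖grad p (x k)‖ * √M := fun k => by
        have h2 := hsub (x k) z
        have h3 := real_inner_le_norm (grad p (x k)) (x k - z)
        rw [← neg_sub (x k) z, inner_neg_right] at h2
        have h4 := mul_le_mul_of_nonneg_left (hM' k) (norm_nonneg (grad p (x k)))
        linarith
      have h2 : Tendsto (fun k => p (x (φ k))) atTop (𝓝 (p xs)) := (hp.tendsto xs).comp hlim
      have h3 : Tendsto (fun k => p z + ‖grad p (x (φ k))‖ * √M) atTop (𝓝 (p z + 0 * √M)) :=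
        ((hg.comp hφ.tendsto_atTop).mul_const _).const_add _
      simpa using le_of_tendsto_of_tendsto' h2 h3 fun k => h1 _
    exact isMinOn_iff.2 fun y hy => hle.trans (isMinOn_iff.1 hz y hy)
  refine ⟨xs, hmin, ?_⟩
  -- Since `xs` is itself a minimizer, the whole sequence of distances to it converges; the
  -- subsequence forces the limit to be 0.
  obtain ⟨Q', hQ'⟩ := hx.exists_tendsto_norm_sub_sq hβ hσ hB hsub hmin
  have h0 : Tendsto (fun k => ‖x (φ k) - xs‖ ^ 2) atTop (𝓝 0) := by
    have h := ((tendsto_iff_norm_sub_tendsto_zero.1 hlim).pow 2)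
    simpa using h
  have hQ0 : Q' = 0 := tendsto_nhds_unique (hQ'.comp hφ.tendsto_atTop) h0
  rw [tendsto_iff_norm_sub_tendsto_zero]
  simpa [hQ0] using hQ'.sqrt

end ArmijoDescent

/-! ### Smoothness of the gauge of a thickened convex set -/

section GaugeOfThickening

variable {E : Type*} [NormedAddCommGroup E] [InnerProductSpace ℝ E]

local notation "⟪" x ", " y "⟫" => inner ℝ x y

/-- `φ` is the gauge of the set of points at distance at most `α` from `D`. -/
structure IsThickeningGauge (D : Set E) (α : ℝ) (φ : E → ℝ) : Prop where
  exists_mem : ∀ w ρ, φ w < ρ → ∃ c ∈ D, ‖w - ρ • c‖ ≤ α * ρ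
  le_of_mem : ∀ w s, 0 < s → ∀ c ∈ D, ‖w - s • c‖ ≤ α * s → φ w ≤ s

variable {D : Set E} {α : ℝ} {φ : E → ℝ}

theorem norm_sub_smul_eq {s : ℝ} (hs : 0 < s) (w c : E) :
    ‖w - s • c‖ = s * ‖s⁻¹ • w - c‖ := by
  rw [← Real.norm_of_nonneg hs.le, ← norm_smul, smul_sub, Real.norm_of_nonneg hs.le,
    smul_inv_smul₀ hs.ne']

/-- The normalized point of a level set of the gauge of a thickening has a nearest point in `D`, at
distance exactly `α`. -/
theorem IsThickeningGauge.exists_projection [CompleteSpace E] (hφ : IsThickeningGauge D α φ)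
    (hDc : Convex ℝ D) (hD : IsClosed D) (hne : D.Nonempty) {w : E} (hw : 0 < φ w) :
    ∃ c ∈ D, ‖(φ w)⁻¹ • w - c‖ = α ∧ ∀ v ∈ D, ⟪(φ w)⁻¹ • w - c, v - c⟫ ≤ 0 := by
  set r := φ w with hr
  set u := r⁻¹ • w with hu
  obtain ⟨c, hc, hcmin⟩ := exists_norm_eq_iInf_of_complete_convex hne hD.isComplete hDc u
  have hmin : ∀ v ∈ D, ‖u - c‖ ≤ ‖u - v‖ := fun v hv => by
    rw [hcmin]
    exact ciInf_le (f := fun v : D => ‖u - v‖)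
      ⟨0, by rintro _ ⟨v, rfl⟩; exact norm_nonneg _⟩ ⟨v, hv⟩
  refine ⟨c, hc, le_antisymm ?_ ?_, (norm_eq_iInf_iff_real_inner_le_zero hDc hc).1 hcmin⟩
  -- For ρ > r some point of `D` is within α of w/ρ; let ρ decrease to r.
  · have hcont : ContinuousAt (fun ρ : ℝ => α + ‖r⁻¹ • w - ρ⁻¹ • w‖) r := by
      have : ContinuousAt (fun ρ : ℝ => ρ⁻¹) r := continuousAt_inv₀ hw.ne'
      fun_prop
    have hlim : Tendsto (fun ρ : ℝ => α + ‖r⁻¹ • w - ρ⁻¹ • w‖) (𝓝[>] r) (𝓝 α) := by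
      have := hcont.tendsto.mono_left (nhdsWithin_le_nhds (s := Ioi r))
      simpa using this
    refine ge_of_tendsto hlim ?_
    filter_upwards [self_mem_nhdsWithin] with ρ hρ
    have hρ0 : 0 < ρ := hw.trans hρ
    obtain ⟨v, hv, hvρ⟩ := hφ.exists_mem w ρ hρ
    rw [norm_sub_smul_eq hρ0, mul_comm, mul_le_mul_iff_left₀ hρ0] at hvρ
    have h1 := norm_add_le (r⁻¹ • w - ρ⁻¹ • w) (ρ⁻¹ • w - v)
    rw [sub_add_sub_cancel] at h1
    linarith [hmin v hv]
  -- If the distance were below α, the same `c` would serve a level slightly below r.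
  · by_contra! hlt
    have hcont : ContinuousAt (fun ρ : ℝ => ‖ρ⁻¹ • w - c‖) r := by
      have : ContinuousAt (fun ρ : ℝ => ρ⁻¹) r := continuousAt_inv₀ hw.ne'
      fun_prop
    have hev : ∀ᶠ ρ in 𝓝[<] r, ‖ρ⁻¹ • w - c‖ < α ∧ 0 < ρ :=
      ((hcont.eventually_lt continuousAt_const hlt).and (lt_mem_nhds hw)).filter_mono
        nhdsWithin_le_nhds
    obtain ⟨ρ, ⟨hρα, hρ0⟩, hρr⟩ := (hev.and self_mem_nhdsWithin).exists
    refine absurd (hφ.le_of_mem w ρ hρ0 c hc ?_) (not_le.2 hρr)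
    rw [norm_sub_smul_eq hρ0, mul_comm]
    exact mul_le_mul_of_nonneg_right hρα.le hρ0.le

/-- A supporting half-space of the thickening bounds its gauge from below by a linear function. -/
theorem IsThickeningGauge.inner_le (hφ : IsThickeningGauge D α φ) {u c : E}
    (hnorm : ‖u - c‖ = α) (hc : ∀ v ∈ D, ⟪u - c, v - c⟫ ≤ 0) (hφ0 : ∀ w, 0 ≤ φ w) (w : E) :
    ⟪u - c, w⟫ ≤ φ w * ⟪u - c, u⟫ := by
  have key : ∀ ρ, φ w < ρ → ⟪u - c, w⟫ ≤ ρ * ⟪u - c, u⟫ := fun ρ hρ => by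
    obtain ⟨v, hv, hvρ⟩ := hφ.exists_mem w ρ hρ
    have hρ0 : 0 < ρ := (hφ0 w).trans_lt hρ
    have h1 := hc v hv
    have h2 := real_inner_le_norm (u - c) (w - ρ • v)
    have h3 := mul_le_mul_of_nonneg_left hvρ (norm_nonneg (u - c))
    rw [inner_sub_right, inner_smul_right] at h2
    rw [inner_sub_right] at h1
    have h4 : ⟪u - c, u⟫ - ⟪u - c, c⟫ = α ^ 2 := by
      rw [← inner_sub_right, real_inner_self_eq_norm_sq, hnorm]
    rw [hnorm] at h2 h3
    nlinarith
  have hlim : Tendsto (fun ρ : ℝ => ρ * ⟪u - c, u⟫) (𝓝[>] φ w) (𝓝 (φ w * ⟪u - c, u⟫)) :=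
    (tendsto_id.mul_const _).mono_left nhdsWithin_le_nhds
  refine ge_of_tendsto hlim ?_
  filter_upwards [self_mem_nhdsWithin] with ρ hρ using key ρ hρ

/-- On bounded sets where it is bounded below by a positive number, the gauge of the thickening of a
closed convex set through the origin has bounded subgradients, with uniform quadratic upper
bounds. -/
theorem IsThickeningGauge.exists_quadratic_bound [CompleteSpace E] (hφ : IsThickeningGauge D α φ)
    (hα : 0 < α) (hφ0 : ∀ w, 0 ≤ φ w) (hDc : Convex ℝ D) (hD : IsClosed D) (h0 : (0 : E) ∈ D)
    {m R : ℝ} (hm : 0 < m) (hR : 0 ≤ R) :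
    ∃ K > 0, ∃ δ > 0, ∀ w, m ≤ φ w → ‖w‖ ≤ R → ∃ a : E, ‖a‖ ≤ 1 / α ∧
      (∀ w', φ w + ⟪a, w' - w⟫ ≤ φ w') ∧
      ∀ h, ‖h‖ ≤ δ → φ (w + h) ≤ φ w + ⟪a, h⟫ + K * ‖h‖ ^ 2 := by
  -- With |e| ≤ (2/α)‖h‖ and ‖u‖ ≤ R/m below, A‖h‖ bounds ‖h - e u‖. `K` satisfies A² = K m α², and
  -- the two entries of the radius give K‖h‖ ≤ 1/α and |e| ≤ m/2.
  set A := 1 + 2 * R / (m * α) with hA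
  have hA0 : 0 < A := by positivity
  set K := A ^ 2 / (m * α ^ 2) with hKdef
  have hK : 0 < K := by positivity
  refine ⟨K, hK, min (1 / (α * K)) (α * m / 4), lt_min (by positivity) (by positivity),
    fun w hmw hwR => ?_⟩
  have hr : 0 < φ w := hm.trans_le hmw
  obtain ⟨c, hc, hnorm, hproj⟩ := hφ.exists_projection hDc hD ⟨0, h0⟩ hr
  set r := φ w with hrdef
  set u := r⁻¹ • w with hu
  set g := u - c with hg
  set q := ⟪g, u⟫ with hq
  have hgg : ⟪g, u⟫ - ⟪g, c⟫ = α ^ 2 := by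
    rw [← inner_sub_right, ← hg, real_inner_self_eq_norm_sq, hnorm]
  have hqα : α ^ 2 ≤ q := by
    have h1 := hproj 0 h0
    rw [zero_sub, inner_neg_right] at h1
    linarith
  have hq0 : 0 < q := lt_of_lt_of_le (by positivity) hqα
  have hw : w = r • u := by rw [hu, smul_inv_smul₀ hr.ne']
  have hgw : ⟪g, w⟫ = r * q := by rw [hw, inner_smul_right]
  have hinner : ∀ v, ⟪q⁻¹ • g, v⟫ = ⟪g, v⟫ / q := fun v => by
    rw [real_inner_smul_left, inv_mul_eq_div]
  have ha : ‖q⁻¹ • g‖ ≤ 1 / α := by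
    rw [norm_smul, hnorm, Real.norm_of_nonneg (inv_nonneg.2 hq0.le), inv_mul_eq_div,
      div_le_div_iff₀ hq0 hα]
    nlinarith
  refine ⟨q⁻¹ • g, ha, fun w' => ?_, fun h hh => ?_⟩
  · have h1 := hφ.inner_le hnorm hproj hφ0 w'
    rw [hinner, inner_sub_right, hgw, sub_div, mul_div_assoc, div_self hq0.ne', mul_one]
    have h2 : ⟪g, w'⟫ / q ≤ φ w' := (div_le_iff₀ hq0).2 h1
    linarith
  · have hh1 : K * ‖h‖ ≤ 1 / α := by
      have := mul_le_mul_of_nonneg_left (hh.trans (min_le_left _ _)) hK.le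
      refine this.trans_eq ?_
      field_simp
    have hh2 : ‖h‖ ≤ α * m / 4 := hh.trans (min_le_right _ _)
    -- The old nearest point `c` is tested at `w + h` with level r + e. The residual is (r + e)g +
    -- (h - e u), and its negative cross term -2(r + e)qK‖h‖² absorbs ‖h - e u‖², because r + e ≥
    -- m/2 and q ≥ α².
    set e := ⟪q⁻¹ • g, h⟫ + K * ‖h‖ ^ 2 with he
    have hae : |⟪q⁻¹ • g, h⟫| ≤ 1 / α * ‖h‖ :=
      (abs_real_inner_le_norm _ _).trans (mul_le_mul_of_nonneg_right ha (norm_nonneg _))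
    have hKh : K * ‖h‖ ^ 2 ≤ 1 / α * ‖h‖ := by
      rw [sq, ← mul_assoc]
      exact mul_le_mul_of_nonneg_right hh1 (norm_nonneg _)
    have hKh0 : 0 ≤ K * ‖h‖ ^ 2 := by positivity
    have hebd : |e| ≤ 2 / α * ‖h‖ := by
      have h1 := abs_le.1 hae
      have h2 : 2 / α * ‖h‖ = 1 / α * ‖h‖ + 1 / α * ‖h‖ := by ring
      rw [abs_le]
      constructor <;> linarith
    have hesmall : |e| ≤ m / 2 := by
      refine hebd.trans ((mul_le_mul_of_nonneg_left hh2 (by positivity)).trans_eq ?_)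
      field_simp
      norm_num
    have hs : m / 2 ≤ r + e := by
      have := (abs_le.1 hesmall).1
      linarith
    have hs0 : 0 < r + e := by linarith
    have huR : ‖u‖ ≤ R / m := by
      rw [hu, norm_smul, Real.norm_of_nonneg (inv_nonneg.2 hr.le), inv_mul_eq_div]
      exact div_le_div₀ hR hwR hm hmw
    have hnb : ‖h - e • u‖ ≤ A * ‖h‖ := by
      have h1 := norm_sub_le h (e • u)
      rw [norm_smul, Real.norm_eq_abs] at h1
      have h2 := mul_le_mul hebd huR (norm_nonneg _) (by positivity)
      have h3 : A * ‖h‖ = ‖h‖ + 2 / α * ‖h‖ * (R / m) := by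
        rw [hA]
        field_simp
      linarith
    have hgh : ⟪g, h - e • u⟫ = -(K * ‖h‖ ^ 2 * q) := by
      have h1 : e * q = ⟪g, h⟫ + K * ‖h‖ ^ 2 * q := by
        rw [he, hinner]
        field_simp
      rw [inner_sub_right, inner_smul_right, ← hq, h1]
      ring
    have hdecomp : w + h - (r + e) • c = (r + e) • g + (h - e • u) := by
      rw [hg]
      nth_rw 1 [hw]
      module
    have hsq : ‖w + h - (r + e) • c‖ ^ 2 ≤ (α * (r + e)) ^ 2 := by
      rw [hdecomp, norm_add_sq_real, real_inner_smul_left, hgh, norm_smul, hnorm,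
        Real.norm_of_nonneg hs0.le]
      have h1 : ‖h - e • u‖ ^ 2 ≤ A ^ 2 * ‖h‖ ^ 2 := by
        rw [← mul_pow]
        exact pow_le_pow_left₀ (norm_nonneg _) hnb 2
      have h2 : A ^ 2 = K * (m * α ^ 2) := by
        rw [hKdef]
        field_simp
      have h3 : m * α ^ 2 ≤ 2 * (r + e) * q :=
        mul_le_mul (by linarith) hqα (by positivity) (by linarith)
      have h4 := mul_le_mul_of_nonneg_left h3 hKh0
      rw [h2] at h1
      nlinarith
    have hfin := hφ.le_of_mem (w + h) (r + e) hs0 c hc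
      ((sq_le_sq₀ (norm_nonneg _) (by positivity)).1 hsq)
    rw [he] at hfin
    linarith

end GaugeOfThickening

/-! ### The polar envelope as a gauge, and its slice at scale one -/

section PolarEnvelope

variable {X : Type*} [NormedAddCommGroup X] [InnerProductSpace ℝ X]

local notation "⟪" x ", " y "⟫" => inner ℝ x y

/-- The part with positive scale of the unit sublevel set of the perspective function. -/
def perspectiveBall (f : X → ℝ≥0∞) : Set (WithLp 2 (X × ℝ)) :=
  {z | 0 < z.snd ∧ ENNReal.ofReal z.snd * f (z.snd⁻¹ • z.fst) ≤ 1}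

variable {f : X → ℝ≥0∞} {α : ℝ}

/-- The combined point divided by its scale l is the average of the points xᵢ/lᵢ with weights a l₁/l
and b l₂/l; convexity of `f` there, multiplied by l, gives the claim. Positive scales avoid the
recession function. -/
theorem convex_perspectiveBall (hf : ConvexOn ℝ≥0 univ f) : Convex ℝ (perspectiveBall f) := by
  rintro z₁ ⟨h₁, hz₁⟩ z₂ ⟨h₂, hz₂⟩ a b ha hb hab
  set l₁ := z₁.snd
  set l₂ := z₂.snd
  set l := a * l₁ + b * l₂ with hl
  have hl0 : 0 < l := by
    rcases ha.eq_or_lt with rfl | ha'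
    · have : b = 1 := by linarith
      simp [hl, this, h₂]
    · exact add_pos_of_pos_of_nonneg (mul_pos ha' h₁) (mul_nonneg hb h₂.le)
  have hsnd : (a • z₁ + b • z₂).snd = l := by simp [hl, l₁, l₂]
  have hfst : (a • z₁ + b • z₂).fst = a • z₁.fst + b • z₂.fst := by simp
  have hw₁ : 0 ≤ a * l₁ / l := by positivity
  have hw₂ : 0 ≤ b * l₂ / l := by positivity
  have hw : a * l₁ / l + b * l₂ / l = 1 := by
    rw [← add_div, ← hl, div_self hl0.ne']
  have hcomb : l⁻¹ • (a • z₁.fst + b • z₂.fst) =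
      (a * l₁ / l).toNNReal • (l₁⁻¹ • z₁.fst) +
        (b * l₂ / l).toNNReal • (l₂⁻¹ • z₂.fst) := by
    rw [NNReal.smul_def, NNReal.smul_def, Real.coe_toNNReal _ hw₁, Real.coe_toNNReal _ hw₂,
      smul_smul, smul_smul, smul_add, smul_smul, smul_smul]
    congr 2 <;> field_simp
  have hconv := hf.2 (mem_univ (l₁⁻¹ • z₁.fst)) (mem_univ (l₂⁻¹ • z₂.fst))
    (zero_le (a := (a * l₁ / l).toNNReal)) (zero_le (a := (b * l₂ / l).toNNReal))
    (by rw [← Real.toNNReal_add hw₁ hw₂, hw, Real.toNNReal_one])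
  rw [← hcomb, ENNReal.smul_def, ENNReal.smul_def, smul_eq_mul, smul_eq_mul] at hconv
  refine ⟨hsnd ▸ hl0, ?_⟩
  rw [hsnd, hfst]
  have e : ∀ c d : ℝ, 0 ≤ c →
      ENNReal.ofReal l * ((c * d / l).toNNReal : ℝ≥0∞) = ENNReal.ofReal c * ENNReal.ofReal d := by
    intro c d hc
    change ENNReal.ofReal l * ENNReal.ofReal (c * d / l) = _
    rw [← ENNReal.ofReal_mul hc, ← ENNReal.ofReal_mul hl0.le, mul_div_cancel₀ _ hl0.ne']
  calc ENNReal.ofReal l * f (l⁻¹ • (a • z₁.fst + b • z₂.fst))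
      ≤ _ := mul_le_mul_right hconv _
    _ = ENNReal.ofReal a * (ENNReal.ofReal l₁ * f (l₁⁻¹ • z₁.fst)) +
        ENNReal.ofReal b * (ENNReal.ofReal l₂ * f (l₂⁻¹ • z₂.fst)) := by
      rw [mul_add, ← mul_assoc, ← mul_assoc, e _ _ ha, e _ _ hb, mul_assoc, mul_assoc]
    _ ≤ ENNReal.ofReal a * 1 + ENNReal.ofReal b * 1 := by gcongr
    _ = 1 := by
      rw [mul_one, mul_one, ← ENNReal.ofReal_add ha hb, hab, ENNReal.ofReal_one]

theorem ofReal_mul_smul {ρ : ℝ} (hρ : 0 < ρ) (z : WithLp 2 (X × ℝ)) :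
    ENNReal.ofReal (ρ • z).snd * f ((ρ • z).snd⁻¹ • (ρ • z).fst) =
      ENNReal.ofReal ρ * (ENNReal.ofReal z.snd * f (z.snd⁻¹ • z.fst)) := by
  rw [WithLp.smul_snd, WithLp.smul_fst, smul_eq_mul, ENNReal.ofReal_mul hρ.le, mul_assoc, smul_smul,
    mul_inv, mul_right_comm, inv_mul_cancel₀ hρ.ne', one_mul]

theorem inv_smul_mem_perspectiveBall {z : WithLp 2 (X × ℝ)} {ρ : ℝ} (hρ : 0 < ρ) (hz : 0 < z.snd)
    (h : ENNReal.ofReal z.snd * f (z.snd⁻¹ • z.fst) ≤ ENNReal.ofReal ρ) :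
    ρ⁻¹ • z ∈ perspectiveBall f := by
  refine ⟨by simpa using mul_pos (inv_pos.2 hρ) hz, ?_⟩
  rw [ofReal_mul_smul (inv_pos.2 hρ)]
  refine (mul_le_mul_right h _).trans ?_
  rw [← ENNReal.ofReal_mul (inv_nonneg.2 hρ.le), inv_mul_cancel₀ hρ.ne', ENNReal.ofReal_one]

/-- Points of scale zero in the sublevel sets of the perspective are limits of points of positive
scale. -/
theorem inv_smul_mem_closure_of_recFun_lt {z : WithLp 2 (X × ℝ)} {ρ : ℝ} (hρ : 0 < ρ)
    (hz : z.snd = 0) (h : recFun f z.fst < ENNReal.ofReal ρ) :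
    ρ⁻¹ • z ∈ closure (perspectiveBall f) := by
  simp only [recFun, iInf_lt_iff] at h
  obtain ⟨μ, hμ, hμρ⟩ := h
  have hμρ' : (μ : ℝ) < ρ := by
    rwa [← ENNReal.ofReal_coe_nnreal, ENNReal.ofReal_lt_ofReal_iff hρ] at hμρ
  rw [mem_asymptoticCone_iff, AffineSpace.asymptoticNhds_eq_smul, ← map₂_smul,
    ← map_prod_eq_map₂, frequently_map] at hμ
  rw [mem_closure_iff_frequently]
  -- The cone condition supplies large t and (d, s) near (z.fst, μ) with f(t d) ≤ t s. Then (d/ρ,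
  -- 1/(ρt)) has perspective value at most s/ρ < 1 and tends to z/ρ.
  have hlim : Tendsto (fun q : ℝ × (X × ℝ) => WithLp.toLp 2 (ρ⁻¹ • q.2.1, ρ⁻¹ * q.1⁻¹))
      (atTop ×ˢ 𝓝 (z.fst, (μ : ℝ))) (𝓝 (ρ⁻¹ • z)) := by
    have h0 : ρ⁻¹ • z = WithLp.toLp 2 (ρ⁻¹ • z.fst, ρ⁻¹ * 0) := by
      have : z = WithLp.toLp 2 (z.fst, z.snd) := rfl
      rw [hz] at this
      nth_rw 1 [this]
      rw [← WithLp.toLp_smul, Prod.smul_mk, smul_eq_mul]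
    rw [h0]
    refine (WithLp.prod_continuous_toLp 2 X ℝ).continuousAt.tendsto.comp ?_
    refine Tendsto.prodMk_nhds ?_ ?_
    · exact ((continuous_fst.tendsto (z.fst, (μ : ℝ))).comp tendsto_snd).const_smul _
    · exact (tendsto_inv_atTop_zero.comp tendsto_fst).const_mul _
  refine hlim.frequently ?_
  have hev : ∀ᶠ q : ℝ × (X × ℝ) in atTop ×ˢ 𝓝 (z.fst, (μ : ℝ)), 0 < q.1 ∧ q.2.2 < ρ :=
    (tendsto_fst.eventually (eventually_gt_atTop 0)).and
      (((continuous_snd.tendsto (z.fst, (μ : ℝ))).comp tendsto_snd).eventually_lt_const hμρ')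
  refine (hμ.and_eventually hev).mono ?_
  rintro ⟨t, d, s⟩ ⟨⟨-, hepi⟩, ht, hs⟩
  simp only at ht hs
  have hpos : 0 < ρ⁻¹ * t⁻¹ := by positivity
  refine ⟨hpos, ?_⟩
  change ENNReal.ofReal (ρ⁻¹ * t⁻¹) * f ((ρ⁻¹ * t⁻¹)⁻¹ • ρ⁻¹ • d) ≤ 1
  have h1 : (ρ⁻¹ * t⁻¹)⁻¹ • ρ⁻¹ • d = t • d := by
    rw [smul_smul]
    congr 1
    field_simp
  rw [h1]
  refine (mul_le_mul_right hepi _).trans ?_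
  rw [← ENNReal.ofReal_mul hpos.le, ENNReal.ofReal_le_one]
  change ρ⁻¹ * t⁻¹ * (t * s) ≤ 1
  have h2 : ρ⁻¹ * t⁻¹ * (t * s) = s / ρ := by field_simp
  rw [h2, div_le_one hρ]
  exact hs.le

theorem inv_smul_mem_closure_perspectiveBall {z : WithLp 2 (X × ℝ)} {ρ : ℝ} (hρ : 0 < ρ)
    (h : perspective f z < ENNReal.ofReal ρ) : ρ⁻¹ • z ∈ closure (perspectiveBall f) := by
  unfold perspective at h
  split_ifs at h with h1 h2
  · exact subset_closure (inv_smul_mem_perspectiveBall hρ h1 h.le)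
  · exact inv_smul_mem_closure_of_recFun_lt hρ h2 h
  · exact absurd h not_top_lt

theorem zero_mem_closure_perspectiveBall (hf : ∃ x, f x ≠ ⊤) :
    (0 : WithLp 2 (X × ℝ)) ∈ closure (perspectiveBall f) := by
  obtain ⟨y, hy⟩ := hf
  have hlim : Tendsto (fun ρ : ℝ => ρ⁻¹ • WithLp.toLp 2 (y, (1 : ℝ))) atTop (𝓝 0) := by
    simpa using (tendsto_inv_atTop_zero (𝕜 := ℝ)).smul_const (WithLp.toLp 2 (y, (1 : ℝ)))
  refine mem_closure_of_tendsto hlim ?_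
  filter_upwards [eventually_gt_atTop 0, eventually_ge_atTop (f y).toReal] with ρ h0 h1
  refine inv_smul_mem_perspectiveBall h0 (by simp) ?_
  simpa using (ENNReal.le_ofReal_iff_toReal_le hy h0.le).2 h1

theorem polarEnvelope_perspective_ne_top (hf : ∃ x, f x ≠ ⊤) (w : WithLp 2 (X × ℝ)) :
    polarEnvelope α (perspective f) w ≠ ⊤ := by
  obtain ⟨y, hy⟩ := hf
  refine ne_top_of_le_ne_top ?_ (iInf_le _ (WithLp.toLp 2 (y, (1 : ℝ))))
  simp [perspective, hy]

/-- By positive homogeneity, bounding both terms of the max by s means that w is within αs of s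
times the unit sublevel set. Slack in the level replaces attainment of the infimum. -/
theorem isThickeningGauge_polarEnvelope (hα : 0 < α) (hf : ∃ x, f x ≠ ⊤) :
    IsThickeningGauge (closure (perspectiveBall f)) α
      (fun w => (polarEnvelope α (perspective f) w).toReal) where
  exists_mem w ρ h := by
    have hρ : 0 < ρ := ENNReal.toReal_nonneg.trans_lt h
    have h1 : polarEnvelope α (perspective f) w < ENNReal.ofReal ρ :=
      (ENNReal.lt_ofReal_iff_toReal_lt (polarEnvelope_perspective_ne_top hf w)).2 h
    obtain ⟨z, hz⟩ := iInf_lt_iff.1 h1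
    obtain ⟨hz1, hz2⟩ := max_lt_iff.1 hz
    refine ⟨_, inv_smul_mem_closure_perspectiveBall hρ hz1, ?_⟩
    rw [smul_inv_smul₀ hρ.ne']
    rw [ENNReal.ofReal_lt_ofReal_iff hρ, one_div, inv_mul_lt_iff₀ hα] at hz2
    exact hz2.le
  le_of_mem w s hs c hc h := by
    -- `c` is only a limit of points of positive scale; replacing it by such a point `c'` costs less
    -- than αη in distance.
    refine le_of_forall_pos_le_add fun η hη => ?_
    obtain ⟨c', ⟨hc0, hc1⟩, hcc⟩ := Metric.mem_closure_iff.1 hc (η * α / s) (by positivity)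
    rw [dist_eq_norm, lt_div_iff₀ hs] at hcc
    have hs' : 0 < (s • c').snd := by simpa using mul_pos hs hc0
    have h1 : perspective f (s • c') ≤ ENNReal.ofReal (s + η) := by
      rw [perspective, if_pos hs', ofReal_mul_smul hs]
      refine (mul_le_mul_right hc1 _).trans ?_
      rw [mul_one]
      exact ENNReal.ofReal_le_ofReal (by linarith)
    have h2 : ‖w - s • c'‖ ≤ α * (s + η) := by
      have h3 := norm_add_le (w - s • c) (s • (c - c'))
      rw [norm_smul, Real.norm_of_nonneg hs.le, smul_sub, sub_add_sub_cancel] at h3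
      linarith
    refine ENNReal.toReal_le_of_le_ofReal (by positivity) ((iInf_le _ (s • c')).trans ?_)
    refine max_le h1 (ENNReal.ofReal_le_ofReal ?_)
    rwa [one_div, inv_mul_le_iff₀ hα]

/-- At scale λ the perspective term is at least λF and the distance term at least (1 - λ)/α. They
balance at λ = 1/(1 + αF), so on either side one of them reaches the common value. -/
theorem le_projPolarEnvelope (hα : 0 < α) (hf : ∃ x, f x ≠ ⊤) {F : ℝ} (hF : 0 ≤ F)
    (hfF : ∀ y, ENNReal.ofReal F ≤ f y) (x : X) :
    F / (1 + α * F) ≤ projPolarEnvelope α f x := by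
  refine (ENNReal.ofReal_le_iff_le_toReal (projPolarEnvelopeENN_ne_top α f hf x)).1 ?_
  refine le_iInf fun z => ?_
  have hden : 0 < 1 + α * F := by positivity
  rcases le_or_gt z.snd (1 / (1 + α * F)) with h | h
  · refine le_max_of_le_right (ENNReal.ofReal_le_ofReal ?_)
    have h1 := WithLp.norm_snd_le (p := 2) _ (WithLp.toLp 2 (x, (1 : ℝ)) - z)
    rw [WithLp.sub_snd, WithLp.toLp_snd] at h1
    have h2 := (le_abs_self _).trans h1
    simp only at h2
    have h3 : F / (1 + α * F) = 1 / α * (1 - 1 / (1 + α * F)) := by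
      field_simp
      ring
    rw [h3]
    exact mul_le_mul_of_nonneg_left (by linarith) (by positivity)
  · have hz : 0 < z.snd := lt_trans (by positivity) h
    refine le_max_of_le_left ?_
    rw [perspective, if_pos hz]
    refine le_trans ?_ (mul_le_mul_right (hfF _) _)
    rw [← ENNReal.ofReal_mul hz.le]
    refine ENNReal.ofReal_le_ofReal ?_
    rw [div_eq_mul_one_div, mul_comm]
    exact mul_le_mul_of_nonneg_right h.le hF

/-- The balancing scale is used with a test point directly below (x, 1), so the distance is exactly
1 - λ. For a minimizer y of `f` this matches the lower bound. -/
theorem projPolarEnvelope_le (hα : 0 < α) {F : ℝ} (hF : 0 ≤ F) {y : X}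
    (hy : f y = ENNReal.ofReal F) :
    projPolarEnvelope α f ((1 + α * F)⁻¹ • y) ≤ F / (1 + α * F) := by
  have hden : 0 < 1 + α * F := by positivity
  refine ENNReal.toReal_le_of_le_ofReal (by positivity)
    ((iInf_le _ (WithLp.toLp 2 ((1 + α * F)⁻¹ • y, (1 + α * F)⁻¹))).trans (max_le ?_ ?_))
  · rw [perspective, WithLp.toLp_fst, WithLp.toLp_snd, if_pos (inv_pos.2 hden)]
    rw [inv_smul_smul₀ (inv_pos.2 hden).ne', hy, ← ENNReal.ofReal_mul (inv_nonneg.2 hden.le),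
      inv_mul_eq_div]
  · refine ENNReal.ofReal_le_ofReal (le_of_eq ?_)
    rw [← WithLp.toLp_sub, Prod.mk_sub_mk, sub_self, WithLp.norm_toLp_snd, Real.norm_of_nonneg]
    · field_simp
      ring
    · rw [sub_nonneg]
      exact inv_le_one_of_one_le₀ (by nlinarith)

/-- Bounded subgradients of the projected polar envelope, with quadratic upper bounds that are
uniform on balls. -/
theorem exists_quadratic_bound_projPolarEnvelope [FiniteDimensional ℝ X] (hα : 0 < α)
    (hf : ∃ x, f x ≠ ⊤) (hconv : ConvexOn ℝ≥0 univ f) {m : ℝ} (hm : 0 < m)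
    (hmle : ∀ x, m ≤ projPolarEnvelope α f x) (R : ℝ) :
    ∃ K > 0, ∃ δ > 0, ∀ x : X, ‖x‖ ≤ R → ∃ a : X, ‖a‖ ≤ 1 / α ∧
      (∀ y, projPolarEnvelope α f x + ⟪a, y - x⟫ ≤ projPolarEnvelope α f y) ∧
      ∀ h, ‖h‖ ≤ δ → projPolarEnvelope α f (x + h) ≤
        projPolarEnvelope α f x + ⟪a, h⟫ + K * ‖h‖ ^ 2 := by
  have : CompleteSpace X := FiniteDimensional.complete ℝ X
  obtain ⟨K, hK, δ, hδ, hφ⟩ := (isThickeningGauge_polarEnvelope hα hf).exists_quadratic_bound hα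
    (fun _ => ENNReal.toReal_nonneg) (convex_perspectiveBall hconv).closure isClosed_closure
    (zero_mem_closure_perspectiveBall hf) hm (R := |R| + 1) (by positivity)
  refine ⟨K, hK, δ, hδ, fun x hx => ?_⟩
  have hnorm : ‖WithLp.toLp 2 (x, (1 : ℝ))‖ ≤ |R| + 1 := by
    have h1 : WithLp.toLp 2 (x, (1 : ℝ)) = WithLp.toLp 2 (x, 0) + WithLp.toLp 2 (0, 1) := by
      rw [← WithLp.toLp_add, Prod.mk_add_mk, add_zero, zero_add]
    rw [h1]
    refine (norm_add_le _ _).trans ?_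
    rw [WithLp.norm_toLp_fst, WithLp.norm_toLp_snd, norm_one]
    linarith [le_abs_self R]
  obtain ⟨a, ha, hsub, hq⟩ := hφ _ (hmle x) hnorm
  -- Increments within the slice have zero scale component, so only the first component of the slope
  -- acts.
  refine ⟨a.fst, (WithLp.norm_fst_le (p := 2) _ a).trans ha, fun y => ?_, fun h hh => ?_⟩
  · have h1 := hsub (WithLp.toLp 2 (y, 1))
    rw [← WithLp.toLp_sub, Prod.mk_sub_mk, sub_self, WithLp.prod_inner_apply] at h1
    simpa [projPolarEnvelope, projPolarEnvelopeENN] using h1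
  · have h1 := hq (WithLp.toLp 2 (h, 0)) (by rwa [WithLp.norm_toLp_fst])
    rw [← WithLp.toLp_add, Prod.mk_add_mk, add_zero, WithLp.norm_toLp_fst,
      WithLp.prod_inner_apply] at h1
    simpa [projPolarEnvelope, projPolarEnvelopeENN] using h1

/-- A subgradient with a local quadratic upper bound is the gradient. -/
theorem hasGradientAt_of_quadratic_bound [CompleteSpace X] {p : X → ℝ} {x a : X} {K δ : ℝ}
    (hδ : 0 < δ) (hsub : ∀ y, p x + ⟪a, y - x⟫ ≤ p y)
    (hq : ∀ h, ‖h‖ ≤ δ → p (x + h) ≤ p x + ⟪a, h⟫ + K * ‖h‖ ^ 2) : HasGradientAt p a x := by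
  rw [hasGradientAt_iff_isLittleO_nhds_zero]
  have h1 : (fun h => p (x + h) - p x - ⟪a, h⟫) =O[𝓝 0] fun h : X => ‖h‖ ^ 2 := by
    refine Asymptotics.IsBigO.of_bound K ?_
    filter_upwards [Metric.closedBall_mem_nhds (0 : X) hδ] with h hh
    have h2 := hq h (by simpa using hh)
    have h3 := hsub (x + h)
    rw [add_sub_cancel_left] at h3
    rw [Real.norm_of_nonneg (by linarith), Real.norm_of_nonneg (by positivity)]
    linarith
  refine h1.trans_isLittleO ?_
  exact Asymptotics.isLittleO_norm_pow_id one_lt_two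

end PolarEnvelope

/-! ### Convergence of EMA -/

theorem mainTheorem8 {X : Type*} [NormedAddCommGroup X] [InnerProductSpace ℝ X]
    [FiniteDimensional ℝ X] (f : X → ℝ≥0∞)
    (hf_proper : ∃ x, f x ≠ ⊤) (hf_closed : LowerSemicontinuous f)
    (hf_convex : ConvexOn ℝ≥0 Set.univ f)
    (hf_pos : 0 < ⨅ x, f x) (hf_argmin : ∃ x, IsMinOn f Set.univ x)
    (α : ℝ) (hα : 0 < α) :
    Differentiable ℝ (projPolarEnvelope α f) ∧
    ∀ (σ : ℝ), σ ∈ Set.Ioo (0 : ℝ) 1 →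
    ∀ (β : ℕ → ℝ), (∀ k, 0 < β k) → 0 < ⨅ k, β k → BddAbove (Set.range β) →
      (∀ x₀ : X, ∃ x : ℕ → X, x 0 = x₀ ∧
        IsArmijoDescentSequence (projPolarEnvelope α f) σ β x) ∧
      (∀ x : ℕ → X, IsArmijoDescentSequence (projPolarEnvelope α f) σ β x →
        ∃ xs : X, IsMinOn (projPolarEnvelope α f) Set.univ xs ∧
          Tendsto x atTop (𝓝 xs)) := by
  have : CompleteSpace X := FiniteDimensional.complete ℝ X
  obtain ⟨y, hy⟩ := hf_argmin
  have hymin : ∀ x, f y ≤ f x := fun x => isMinOn_iff.1 hy x (mem_univ x)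
  have hytop : f y ≠ ⊤ := by
    obtain ⟨x, hx⟩ := hf_proper
    exact ne_top_of_le_ne_top hx (hymin x)
  have hF : 0 < (f y).toReal := ENNReal.toReal_pos (hf_pos.trans_le (iInf_le _ y)).ne' hytop
  have hfy : f y = ENNReal.ofReal (f y).toReal := (ENNReal.ofReal_toReal hytop).symm
  set F := (f y).toReal
  set p := projPolarEnvelope α f
  have hmle : ∀ x, F / (1 + α * F) ≤ p x :=
    le_projPolarEnvelope hα hf_proper hF.le fun x => hfy ▸ hymin x
  have hmin : IsMinOn p univ ((1 + α * F)⁻¹ • y) := isMinOn_iff.2 fun x _ =>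
    (projPolarEnvelope_le hα hF.le hfy).trans (hmle x)
  have hbound := exists_quadratic_bound_projPolarEnvelope hα hf_proper hf_convex
    (by positivity : 0 < F / (1 + α * F)) hmle
  have hgrad : ∀ x, ∃ a : X, ‖a‖ ≤ 1 / α ∧ (∀ y, p x + inner ℝ a (y - x) ≤ p y) ∧
      HasGradientAt p a x := fun x => by
    obtain ⟨K, -, δ, hδ, h⟩ := hbound ‖x‖
    obtain ⟨a, ha, hsub, hq⟩ := h x le_rfl
    exact ⟨a, ha, hsub, hasGradientAt_of_quadratic_bound hδ hsub hq⟩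
  have hgradeq : ∀ {x a : X}, HasGradientAt p a x → grad p x = a := fun h => h.gradient
  have hL : ∀ x, ‖grad p x‖ ≤ 1 / α := fun x => by
    obtain ⟨a, ha, -, h⟩ := hgrad x
    rwa [hgradeq h]
  have hsub : ∀ x y, p x + inner ℝ (grad p x) (y - x) ≤ p y := fun x => by
    obtain ⟨a, -, ha, h⟩ := hgrad x
    rwa [hgradeq h]
  have hquad : ∀ R, ∃ K > 0, ∃ δ > 0, ∀ x, ‖x‖ ≤ R → ∀ h, ‖h‖ ≤ δ →
      p (x + h) ≤ p x + inner ℝ (grad p x) h + K * ‖h‖ ^ 2 := fun R => by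
    obtain ⟨K, hK, δ, hδ, h⟩ := hbound R
    refine ⟨K, hK, δ, hδ, fun x hx => ?_⟩
    obtain ⟨a, -, hsub, hq⟩ := h x hx
    -- The slope obtained for radius R is the gradient by uniqueness, so `K` and `δ` serve the whole
    -- ball.
    rwa [hgradeq (hasGradientAt_of_quadratic_bound hδ hsub hq)]
  have hdiff : Differentiable ℝ p := fun x => by
    obtain ⟨a, -, -, h⟩ := hgrad x
    exact h.differentiableAt
  refine ⟨hdiff, fun σ hσ β hβ hβinf hβsup => ⟨fun x₀ => ?_, fun x hx => ?_⟩⟩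
  · refine exists_isArmijoDescentSequence (fun k x => ?_) x₀
    obtain ⟨K, hK, δ, hδ, h⟩ := hquad ‖x‖
    have hσ1 : 0 < 1 - σ := sub_pos.2 hσ.2
    have hτ : 0 < min (δ / (1 / α + 1)) ((1 - σ) / K) := lt_min (by positivity) (by positivity)
    have hlim : Tendsto (fun t : ℕ => (1 / 2 : ℝ) ^ t * β k) atTop (𝓝 0) := by
      simpa using (tendsto_pow_atTop_nhds_zero_of_lt_one (by norm_num : (0 : ℝ) ≤ 1 / 2)
        (by norm_num)).mul_const (β k)
    obtain ⟨t, ht⟩ := (hlim.eventually_lt_const hτ).exists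
    exact ⟨t, armijoTest_of_le hK (by positivity) (hL x) (hβ k) (h x le_rfl) ht.le⟩
  · obtain ⟨B, hB⟩ := hβsup
    have hbdd : BddBelow (range β) := ⟨0, by rintro _ ⟨k, rfl⟩; exact (hβ k).le⟩
    exact hx.exists_tendsto hβ hσ.1 hσ.2 (fun k => hB ⟨k, rfl⟩) hβinf (ciInf_le hbdd)
      hdiff.continuous hsub hL hquad hmin
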